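/- Let $m\le n$ be non-negative integers, let $B\subset\mathbb{C}^n$ be a closed Euclidean ball of positive radius with boundary sphere $S$, and let $g:B\to\mathbb{C}^m$ be holomorphic, in the sense that $g$ is continuous on $B$ and holomorphic on the open ball $B\setminus S$ (for instance, $g$ is holomorphic on a neighbourhood of $B$). Let $\delta>0$, and call a connected component of $\{z\in B : |g(z)|\le\delta\}$, where $|\cdot|$ is the Euclidean norm, an island if it is disjoint from $S$. Then every island has non-empty interior, and this interior contains a zero of $g$. -/

import Mathlib

/-- The part of the sublevel set `{|g| ≤ δ}` lying in the closed ball of centre `c` and radius `r`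
in `ℂⁿ`, i.e. `g⁻¹(B_δ) ∩ B_r`, where `B_δ` is the closed Euclidean ball of radius `δ` in `ℂᵐ`. -/
def ballSublevel {n m : ℕ} (g : EuclideanSpace ℂ (Fin n) → EuclideanSpace ℂ (Fin m))
    (c : EuclideanSpace ℂ (Fin n)) (r δ : ℝ) : Set (EuclideanSpace ℂ (Fin n)) :=
  {z | z ∈ Metric.closedBall c r ∧ ‖g z‖ ≤ δ}

/-- `K` is an island of `{|g| ≤ δ}` in the closed ball of centre `c` and radius `r`: a connected
component of the sublevel set in the ball which is disjoint from the boundary sphere. -/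
structure IsIsland {n m : ℕ} (g : EuclideanSpace ℂ (Fin n) → EuclideanSpace ℂ (Fin m))
    (c : EuclideanSpace ℂ (Fin n)) (r δ : ℝ) (K : Set (EuclideanSpace ℂ (Fin n))) : Prop where
  isComponent : ∃ z ∈ ballSublevel g c r δ, K = connectedComponentIn (ballSublevel g c r δ) z
  disjoint_sphere : Disjoint K (Metric.sphere c r)

/-- `g` is holomorphic on the closed ball of centre `c` and radius `r`, in the weak sense:
continuous on the closed ball and complex differentiable at every point of the open ball.
Every map that is holomorphic on a neighbourhood of the closed ball satisfies this. -/
structure HolomorphicOnClosedBall {n m : ℕ}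
    (g : EuclideanSpace ℂ (Fin n) → EuclideanSpace ℂ (Fin m))
    (c : EuclideanSpace ℂ (Fin n)) (r : ℝ) : Prop where
  continuousOn : ContinuousOn g (Metric.closedBall c r)
  differentiableOn : DifferentiableOn ℂ g (Metric.ball c r)

/-! If an island had no zero, a clopen piece `L` of the sublevel set around it would avoid both the
sphere and the zeros, and a compact neighbourhood `C` of `L` would have `‖g‖ > δ` on its boundary.
So it suffices to find a zero in such a `C` (`exists_zero_of_lt_norm_on_boundary`). Otherwise, for
small `ε`, the function `‖g‖² exp (-ε ‖·‖²)` has an interior minimum `q` on `C`. As `m ≤ n`, some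
direction `h ≠ 0` has `Dg(q) h` in the line of `g q`; along it `g` is, to first order, a scalar
holomorphic function times `g q`. The Gaussian weight absorbs the error, so the maximum principle in
one variable excludes the minimum. Zeros of `g` on an island are interior by continuity, since `δ >
0`. -/

open Filter Topology in
/-- Along a complex line on which `G` is tangent to the line spanned by `G 0 ≠ 0`, the function
`‖G‖² exp (-ε ‖·‖²)` has no local minimum. -/
theorem not_isLocalMin_norm_sq_mul_exp_of_hasDerivAt_smul
    {E F : Type*} [NormedAddCommGroup E] [InnerProductSpace ℂ E]
    [NormedAddCommGroup F] [InnerProductSpace ℂ F]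
    {G : ℂ → F} {κ : ℂ} (hd : ∀ᶠ t in 𝓝 (0 : ℂ), DifferentiableAt ℂ G t)
    (hG0 : G 0 ≠ 0) (hG' : HasDerivAt G (κ • G 0) 0) {ε : ℝ} (hε : 0 < ε) (q h : E) (hh : h ≠ 0) :
    ¬ IsLocalMin (fun t : ℂ => ‖G t‖ ^ 2 * Real.exp (-(ε * ‖q + t • h‖ ^ 2))) 0 := by
  intro hmin
  set a := G 0 with ha
  have hapos : 0 < ‖a‖ := norm_pos_iff.2 hG0
  have haC : ((‖a‖ : ℂ) ^ 2) ≠ 0 := by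
    exact pow_ne_zero 2 (Complex.ofReal_ne_zero.2 hapos.ne')
  -- `l t • a` is the orthogonal projection of `G t` to the line of `a`.
  set l : ℂ → ℂ := fun t => inner ℂ a (G t) / (‖a‖ : ℂ) ^ 2 with hl
  have hl0 : l 0 = 1 := by
    simp only [hl, ← ha, inner_self_eq_norm_sq_to_K]
    exact div_self haC
  have hld : ∀ᶠ t in 𝓝 (0 : ℂ), DifferentiableAt ℂ l t := by
    filter_upwards [hd] with t ht
    exact ((innerSL ℂ a).differentiableAt.comp t ht).div_const _
  have hlc : ContinuousAt l 0 := hld.self_of_nhds.continuousAt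
  have hl' : HasDerivAt l κ 0 := by
    have h1 : HasDerivAt (fun t => inner ℂ a (G t)) (inner ℂ a (κ • a)) 0 :=
      (innerSL ℂ a).hasFDerivAt.comp_hasDerivAt 0 hG'
    have h2 := h1.div_const ((‖a‖ : ℂ) ^ 2)
    have h3 : inner ℂ a (κ • a) / (‖a‖ : ℂ) ^ 2 = κ := by
      rw [inner_smul_right, inner_self_eq_norm_sq_to_K]
      exact mul_div_cancel_right₀ κ haC
    rw [h3] at h2
    exact h2
  set N : ℂ → F := fun t => G t - l t • a with hN
  have hN0 : N 0 = 0 := by simp [hN, hl0, ← ha]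
  have hN' : HasDerivAt N 0 0 := by
    have := hG'.sub (hl'.smul_const a)
    rw [sub_self] at this
    exact this
  have hpyth : ∀ t, ‖G t‖ ^ 2 = ‖l t‖ ^ 2 * ‖a‖ ^ 2 + ‖N t‖ ^ 2 := by
    intro t
    have horth : inner ℂ (l t • a) (N t) = 0 := by
      rw [inner_smul_left, hN]
      simp only [inner_sub_right, inner_smul_right, inner_self_eq_norm_sq_to_K]
      have : inner ℂ a (G t) - l t * (‖a‖ : ℂ) ^ 2 = 0 := by
        simp only [hl]; rw [div_mul_cancel₀ _ haC, sub_self]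
      exact mul_eq_zero_of_right _ this
    have h3 := norm_add_sq_eq_norm_sq_add_norm_sq_of_inner_eq_zero (𝕜 := ℂ) (l t • a) (N t) horth
    have h4 : l t • a + N t = G t := by simp [hN]
    rw [h4, norm_smul] at h3
    nlinarith [h3]
  set η : ℝ := ε * ‖h‖ ^ 2 with hη
  have hηpos : 0 < η := by have := norm_pos_iff.2 hh; positivity
  -- The exponential carries the part of the weight that is the modulus of a holomorphic function;
  -- what remains is the gain `η ‖t‖²` (see `hexp`).
  set k : ℂ → ℂ := fun t => Complex.exp (ε * (inner ℂ q h * t)) / l t with hk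
  have hk0 : k 0 = 1 := by simp [hk, hl0]
  have hlne : ∀ᶠ t in 𝓝 (0 : ℂ), (1 / 2 : ℝ) < ‖l t‖ := by
    refine hlc.norm.eventually (lt_mem_nhds ?_)
    simp only [hl0, norm_one]; norm_num
  have hkd : ∀ᶠ t in 𝓝 (0 : ℂ), DifferentiableAt ℂ k t := by
    filter_upwards [hld, hlne] with t ht hne
    have : l t ≠ 0 := by intro h0; rw [h0, norm_zero] at hne; norm_num at hne
    exact DifferentiableAt.div (by fun_prop) ht this
  -- Squared, this bound is `‖a‖² η ‖t‖² / 16`, which the gain beats because `‖l t‖² > 1/4`.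
  have hsmall : ∀ᶠ t in 𝓝 (0 : ℂ), ‖N t‖ ≤ (‖a‖ * Real.sqrt η / 4) * ‖t‖ := by
    have := hN'.isLittleO
    have h5 := this.def (c := ‖a‖ * Real.sqrt η / 4) (by positivity)
    simpa [hN0] using h5
  have hexp : ∀ t : ℂ, ε * ‖q + t • h‖ ^ 2
      = ε * ‖q‖ ^ 2 + 2 * (ε * (inner ℂ q h * t)).re + η * ‖t‖ ^ 2 := by
    intro t
    rw [norm_add_sq (𝕜 := ℂ), inner_smul_right, norm_smul, hη, Complex.re_ofReal_mul,
      mul_comm t]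
    simp only [RCLike.re_to_complex]
    ring
  have hlt : ∀ᶠ t in 𝓝 (0 : ℂ), t ≠ 0 → ‖k t‖ < 1 := by
    filter_upwards [hlne, hsmall, hmin] with t hne hs hm ht
    have htpos : 0 < ‖t‖ := norm_pos_iff.2 ht
    simp only [zero_smul, add_zero, ← ha, hexp t, hpyth t] at hm
    set x := (ε * (inner ℂ q h * t)).re with hx
    have hknorm : ‖k t‖ = Real.exp x / ‖l t‖ := by
      simp only [hk]; rw [norm_div, Complex.norm_exp]
    rw [hknorm, div_lt_one (by linarith)]
    have hN2 : ‖N t‖ ^ 2 ≤ ‖a‖ ^ 2 * η / 16 * ‖t‖ ^ 2 := by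
      calc ‖N t‖ ^ 2 ≤ ((‖a‖ * Real.sqrt η / 4) * ‖t‖) ^ 2 :=
            pow_le_pow_left₀ (norm_nonneg _) hs 2
        _ = ‖a‖ ^ 2 * (Real.sqrt η) ^ 2 / 16 * ‖t‖ ^ 2 := by ring
        _ = _ := by rw [Real.sq_sqrt hηpos.le]
    have hm2 : ‖a‖ ^ 2 * (Real.exp x ^ 2 * Real.exp (η * ‖t‖ ^ 2))
        ≤ ‖l t‖ ^ 2 * ‖a‖ ^ 2 + ‖N t‖ ^ 2 := by
      have h6 := mul_le_mul_of_nonneg_right hm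
        (Real.exp_pos (ε * ‖q‖ ^ 2 + 2 * x + η * ‖t‖ ^ 2)).le
      rw [mul_assoc (‖a‖ ^ 2), mul_assoc (_ + _), ← Real.exp_add, ← Real.exp_add] at h6
      have e1 : -(ε * ‖q‖ ^ 2) + (ε * ‖q‖ ^ 2 + 2 * x + η * ‖t‖ ^ 2)
        = x + x + η * ‖t‖ ^ 2 := by ring
      rw [e1, neg_add_cancel, Real.exp_zero, mul_one, Real.exp_add, Real.exp_add, ← sq] at h6
      exact h6
    have hm3 : Real.exp x ^ 2 * (1 + η * ‖t‖ ^ 2) ≤ ‖l t‖ ^ 2 + η / 16 * ‖t‖ ^ 2 := by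
      have h7 : η * ‖t‖ ^ 2 + 1 ≤ Real.exp (η * ‖t‖ ^ 2) := Real.add_one_le_exp _
      have h8 : ‖a‖ ^ 2 * (Real.exp x ^ 2 * (1 + η * ‖t‖ ^ 2))
          ≤ ‖a‖ ^ 2 * (‖l t‖ ^ 2 + η / 16 * ‖t‖ ^ 2) := by
        calc _ ≤ ‖a‖ ^ 2 * (Real.exp x ^ 2 * Real.exp (η * ‖t‖ ^ 2)) := by
              gcongr; linarith
          _ ≤ _ := by linarith
      exact le_of_mul_le_mul_left h8 (by positivity)
    -- If `‖l t‖ ≤ exp x`, then `hm3` forces `(exp x)² ≤ 1/16`, against `‖l t‖ > 1/2`.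
    by_contra hcon
    have h9 : ‖l t‖ ^ 2 ≤ Real.exp x ^ 2 :=
      pow_le_pow_left₀ (norm_nonneg _) (not_lt.1 hcon) 2
    have h10 : (1 / 4 : ℝ) < ‖l t‖ ^ 2 := by nlinarith
    have h11 : 0 < η * ‖t‖ ^ 2 := by positivity
    nlinarith
  have hmax : IsLocalMax (norm ∘ k) 0 := by
    filter_upwards [hlt] with t ht
    rcases eq_or_ne t 0 with rfl | h0
    · exact le_rfl
    · simpa [hk0] using (ht h0).le
  have hconst := Complex.eventually_eq_of_isLocalMax_norm hkd hmax
  have hfalse : ∀ᶠ t in 𝓝[≠] (0 : ℂ), False := by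
    filter_upwards [hconst.filter_mono nhdsWithin_le_nhds, hlt.filter_mono nhdsWithin_le_nhds,
      self_mem_nhdsWithin] with t h1 h2 h3
    have := h2 h3
    rw [h1, hk0] at this
    simp at this
  exact (hfalse.exists).elim fun _ h => h

/-- A linear map into a space of no larger dimension maps some nonzero vector into any prescribed
line. -/
theorem exists_ne_zero_apply_eq_smul {𝕜 E F : Type*} [Field 𝕜] [AddCommGroup E] [Module 𝕜 E]
    [AddCommGroup F] [Module 𝕜 F] [FiniteDimensional 𝕜 E] [FiniteDimensional 𝕜 F]
    (hdim : Module.finrank 𝕜 F ≤ Module.finrank 𝕜 E) (A : E →ₗ[𝕜] F) {a : F} (ha : a ≠ 0) :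
    ∃ h : E, h ≠ 0 ∧ ∃ κ : 𝕜, A h = κ • a := by
  -- Dividing out the line of `a` lowers the dimension by one, so the induced map has a kernel.
  have hlt : Module.finrank 𝕜 (F ⧸ (𝕜 ∙ a)) < Module.finrank 𝕜 E := by
    have h1 := Submodule.finrank_quotient_add_finrank (𝕜 ∙ a)
    rw [finrank_span_singleton ha] at h1
    omega
  have hker := LinearMap.ker_ne_bot_of_finrank_lt (f := (𝕜 ∙ a).mkQ ∘ₗ A) hlt
  obtain ⟨h, hmem, hne⟩ := Submodule.exists_mem_ne_zero_of_ne_bot hker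
  refine ⟨h, hne, ?_⟩
  have h2 : A h ∈ 𝕜 ∙ a := by simpa using hmem
  obtain ⟨κ, hκ⟩ := Submodule.mem_span_singleton.1 h2
  exact ⟨κ, hκ.symm⟩

open Filter Topology in
/-- Off its zeros, a holomorphic map `g` into a space of no larger dimension is such that
`‖g‖² exp (-ε ‖·‖²)` has no local minimum. -/
theorem not_isLocalMin_norm_sq_mul_exp
    {E F : Type*} [NormedAddCommGroup E] [InnerProductSpace ℂ E] [FiniteDimensional ℂ E]
    [NormedAddCommGroup F] [InnerProductSpace ℂ F] [FiniteDimensional ℂ F]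
    (hdim : Module.finrank ℂ F ≤ Module.finrank ℂ E) {g : E → F} {q : E}
    (hd : ∀ᶠ z in 𝓝 q, DifferentiableAt ℂ g z) (hq : g q ≠ 0) {ε : ℝ} (hε : 0 < ε) :
    ¬ IsLocalMin (fun z : E => ‖g z‖ ^ 2 * Real.exp (-(ε * ‖z‖ ^ 2))) q := by
  intro hmin
  obtain ⟨h, hne, κ, hκ⟩ := exists_ne_zero_apply_eq_smul hdim (fderiv ℂ g q).toLinearMap hq
  have hline : ∀ t : ℂ, DifferentiableAt ℂ (fun t : ℂ => q + t • h) t := fun t => by fun_prop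
  have htend : Tendsto (fun t : ℂ => q + t • h) (𝓝 0) (𝓝 q) := by
    have := (hline 0).continuousAt.tendsto
    simpa using this
  have hlineD : HasDerivAt (fun t : ℂ => q + t • h) h 0 := by
    simpa using ((hasDerivAt_id (0 : ℂ)).smul_const h).const_add q
  refine not_isLocalMin_norm_sq_mul_exp_of_hasDerivAt_smul (G := fun t : ℂ => g (q + t • h))
    (κ := κ) ?_ (by simpa using hq) ?_ hε q h hne ?_
  · filter_upwards [htend.eventually hd] with t ht
    exact ht.comp t (hline t)
  · have h1 : HasFDerivAt g (fderiv ℂ g q) (q + (0 : ℂ) • h) := by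
      simpa using hd.self_of_nhds.hasFDerivAt
    have h2 := h1.comp_hasDerivAt (0 : ℂ) hlineD
    have h3 : fderiv ℂ g q h = κ • g (q + (0 : ℂ) • h) := by simpa using hκ
    rw [← h3]
    exact h2
  · have := htend.eventually hmin
    filter_upwards [this] with t ht
    simpa using ht

open Filter Topology in
/-- A holomorphic map into a space of no larger dimension which is larger on the boundary of a
compact set than at some point of the set has a zero in the set. -/
theorem exists_zero_of_lt_norm_on_boundary
    {E F : Type*} [NormedAddCommGroup E] [InnerProductSpace ℂ E] [FiniteDimensional ℂ E]
    [NormedAddCommGroup F] [InnerProductSpace ℂ F] [FiniteDimensional ℂ F]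
    (hdim : Module.finrank ℂ F ≤ Module.finrank ℂ E) {g : E → F} {C : Set E} (hC : IsCompact C)
    (hgc : ContinuousOn g C) (hgd : DifferentiableOn ℂ g (interior C)) {p : E} (hp : p ∈ C)
    {δ : ℝ} (hpδ : ‖g p‖ ≤ δ) (hbd : ∀ z ∈ C \ interior C, δ < ‖g z‖) :
    ∃ z ∈ C, g z = 0 := by
  by_contra! hzero
  have hδ : 0 ≤ δ := (norm_nonneg _).trans hpδ
  obtain ⟨M, hδM, hM⟩ : ∃ M, δ < M ∧ ∀ z ∈ C \ interior C, M ≤ ‖g z‖ := by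
    rcases (C \ interior C).eq_empty_or_nonempty with he | hne
    · exact ⟨δ + 1, by linarith, by simp [he]⟩
    · obtain ⟨w, hw, hwmin⟩ := (hC.diff isOpen_interior).exists_isMinOn hne
        (hgc.norm.mono Set.sdiff_subset)
      exact ⟨‖g w‖, hbd w hw, fun z hz => hwmin hz⟩
  obtain ⟨R, hR⟩ := hC.isBounded.exists_norm_le
  -- The weight must not close the gap between `δ` at `p` and `M` on the boundary.
  obtain ⟨ε, hε, hεM⟩ : ∃ ε : ℝ, 0 < ε ∧ δ ^ 2 < M ^ 2 * Real.exp (-(ε * R ^ 2)) := by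
    have hcont : ContinuousAt (fun ε : ℝ => M ^ 2 * Real.exp (-(ε * R ^ 2))) 0 := by fun_prop
    have hev := hcont.eventually (lt_mem_nhds (a := δ ^ 2)
      (by simpa using pow_lt_pow_left₀ hδM hδ two_ne_zero))
    obtain ⟨ε, h1, h2⟩ := ((hev.filter_mono nhdsWithin_le_nhds).and
      (self_mem_nhdsWithin (s := Set.Ioi (0 : ℝ)))).exists
    exact ⟨ε, h2, h1⟩
  obtain ⟨q, hqC, hq⟩ := hC.exists_isMinOn
    (f := fun z : E => ‖g z‖ ^ 2 * Real.exp (-(ε * ‖z‖ ^ 2))) ⟨p, hp⟩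
    ((hgc.norm.pow 2).mul (by fun_prop))
  have hqi : q ∈ interior C := by
    by_contra hqn
    have h1 : ‖g q‖ ^ 2 * Real.exp (-(ε * ‖q‖ ^ 2)) ≤ ‖g p‖ ^ 2 * Real.exp (-(ε * ‖p‖ ^ 2)) :=
      hq hp
    have h2 : ‖g p‖ ^ 2 * Real.exp (-(ε * ‖p‖ ^ 2)) ≤ δ ^ 2 * 1 := by
      gcongr
      rw [Real.exp_le_one_iff]
      have : 0 ≤ ε * ‖p‖ ^ 2 := by positivity
      linarith
    have h3 : M ^ 2 * Real.exp (-(ε * R ^ 2)) ≤ ‖g q‖ ^ 2 * Real.exp (-(ε * ‖q‖ ^ 2)) := by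
      have hMq := hM q ⟨hqC, hqn⟩
      have hRq := hR q hqC
      have hM0 : 0 ≤ M := hδ.trans hδM.le
      gcongr
    linarith
  refine not_isLocalMin_norm_sq_mul_exp hdim ?_ (hzero q hqC) hε
    (hq.isLocalMin (mem_interior_iff_mem_nhds.1 hqi))
  filter_upwards [isOpen_interior.mem_nhds hqi] with z hz
  exact hgd.differentiableAt (isOpen_interior.mem_nhds hz)

/-! ### Isolating an island from the rest of the sublevel set -/

/-- In a compact Hausdorff space, every open set containing a connected component contains a
clopen neighbourhood of that component. -/
theorem exists_isClopen_subset_of_connectedComponent_subset {X : Type*} [TopologicalSpace X]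
    [T2Space X] [CompactSpace X] {x : X} {U : Set X} (hU : IsOpen U)
    (h : connectedComponent x ⊆ U) : ∃ L : Set X, IsClopen L ∧ x ∈ L ∧ L ⊆ U := by
  rw [connectedComponent_eq_iInter_isClopen] at h
  have : Nonempty { s : Set X // IsClopen s ∧ x ∈ s } :=
    ⟨⟨Set.univ, isClopen_univ, Set.mem_univ x⟩⟩
  obtain ⟨L, hL⟩ := exists_subset_nhds_of_compactSpace
    (V := fun s : { s : Set X // IsClopen s ∧ x ∈ s } => (s : Set X))
    (fun s t => ⟨⟨s ∩ t, s.2.1.inter t.2.1, s.2.2, t.2.2⟩,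
      Set.inter_subset_left, Set.inter_subset_right⟩)
    (fun s => s.2.1.isClosed) (fun y hy => hU.mem_nhds (h hy))
  exact ⟨L, L.2.1, L.2.2, hL⟩

/-- Every island contains a zero. -/
theorem IsIsland.exists_zero {n m : ℕ} (hmn : m ≤ n) {c : EuclideanSpace ℂ (Fin n)} {r δ : ℝ}
    (hδ : 0 ≤ δ) {g : EuclideanSpace ℂ (Fin n) → EuclideanSpace ℂ (Fin m)}
    (hg : HolomorphicOnClosedBall g c r) {K : Set (EuclideanSpace ℂ (Fin n))}
    (hK : IsIsland g c r δ K) : ∃ z ∈ K, g z = 0 := by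
  obtain ⟨⟨x, hx, rfl⟩, hS⟩ := hK
  by_contra! hzero
  set X := ballSublevel g c r δ with hX
  have hXcl : IsClosed X :=
    hg.continuousOn.norm.preimage_isClosed_of_isClosed Metric.isClosed_closedBall
      (isClosed_Iic (a := δ))
  have hXc : IsCompact X := (isCompact_closedBall c r).of_isClosed_subset hXcl fun z hz => hz.1
  have : CompactSpace X := isCompact_iff_compactSpace.1 hXc
  have hgX : Continuous (fun z : X => g z) :=
    (hg.continuousOn.mono fun z hz => hz.1).domRestrict
  have hcomp := connectedComponentIn_eq_image hx
  obtain ⟨L, hL, hxL, hLU⟩ := exists_isClopen_subset_of_connectedComponent_subset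
    (x := (⟨x, hx⟩ : X)) (U := {z : X | (z : EuclideanSpace ℂ (Fin n)) ∉ Metric.sphere c r} ∩
      {z : X | g z ≠ 0})
    ((Metric.isClosed_sphere.isOpen_compl.preimage continuous_subtype_val).inter
      (isOpen_ne.preimage hgX))
    (fun z hz => by
      have hzK : (z : EuclideanSpace ℂ (Fin n)) ∈ connectedComponentIn X x := by
        rw [hcomp]; exact ⟨z, hz, rfl⟩
      exact ⟨fun hs => Set.disjoint_left.1 hS hzK hs, hzero z hzK⟩)
  obtain ⟨U, hU, hUL⟩ := isOpen_induced_iff.1 hL.isOpen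
  have hLc : IsCompact (Subtype.val '' L) := hL.isClosed.isCompact.image continuous_subtype_val
  have hmem : ∀ z, z ∈ U → ∀ hz : z ∈ X, (⟨z, hz⟩ : X) ∈ L := fun z hzU hz => by
    rw [← hUL]; exact hzU
  -- The sublevel points in `C` all lie in `L`, hence in `interior C`.
  obtain ⟨C, hC, hLC, hCU⟩ := exists_compact_between hLc (hU.inter (Metric.isOpen_ball (x := c)
    (ε := r))) (by
      rintro _ ⟨z, hz, rfl⟩
      refine ⟨?_, lt_of_le_of_ne z.2.1 (hLU hz).1⟩
      rw [← hUL] at hz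
      exact hz)
  have hmemC : ∀ z ∈ C, ∀ h : ‖g z‖ ≤ δ, ∃ hz : z ∈ X, (⟨z, hz⟩ : X) ∈ L := fun z hz h =>
    have hzX : z ∈ X := ⟨Metric.ball_subset_closedBall (hCU hz).2, h⟩
    ⟨hzX, hmem z (hCU hz).1 hzX⟩
  obtain ⟨z, hzC, hz0⟩ := exists_zero_of_lt_norm_on_boundary (by simpa using hmn) hC
    (hg.continuousOn.mono fun z hz => Metric.ball_subset_closedBall (hCU hz).2)
    (hg.differentiableOn.mono fun z hz => (hCU (interior_subset hz)).2)
    (interior_subset (hLC ⟨_, hxL, rfl⟩)) hx.2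
    (fun z hz => by
      by_contra hle
      obtain ⟨hzX, hzL⟩ := hmemC z hz.1 (not_lt.1 hle)
      exact hz.2 (hLC ⟨_, hzL, rfl⟩))
  obtain ⟨hzX, hzL⟩ := hmemC z hzC (by simpa [hz0] using hδ)
  exact (hLU hzL).2 hz0

open Topology in
/-- The zeros of `g` on an island are interior points of the island. -/
theorem IsIsland.mem_interior_of_eq_zero {n m : ℕ} {c : EuclideanSpace ℂ (Fin n)} {r δ : ℝ}
    (hδ : 0 < δ) {g : EuclideanSpace ℂ (Fin n) → EuclideanSpace ℂ (Fin m)}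
    (hg : HolomorphicOnClosedBall g c r) {K : Set (EuclideanSpace ℂ (Fin n))}
    (hK : IsIsland g c r δ K) {z : EuclideanSpace ℂ (Fin n)} (hz : z ∈ K) (hz0 : g z = 0) :
    z ∈ interior K := by
  obtain ⟨⟨x, hx, rfl⟩, hS⟩ := hK
  have hzX := connectedComponentIn_subset _ _ hz
  have hzb : z ∈ Metric.ball c r :=
    lt_of_le_of_ne hzX.1 (Set.disjoint_left.1 hS hz)
  have hball := Metric.isOpen_ball.mem_nhds hzb
  have hcont : ContinuousAt g z := (hg.differentiableOn.differentiableAt hball).continuousAt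
  have hsub : ballSublevel g c r δ ∈ 𝓝 z := by
    filter_upwards [hball,
      hcont.norm.eventually (Iio_mem_nhds (by simpa [hz0] using hδ : ‖g z‖ < δ))]
      with w hw hw'
    exact ⟨Metric.ball_subset_closedBall hw, hw'.le⟩
  obtain ⟨ρ, hρ, hρX⟩ := Metric.mem_nhds_iff.1 hsub
  rw [connectedComponentIn_eq hz, mem_interior_iff_mem_nhds]
  exact Filter.mem_of_superset (Metric.ball_mem_nhds z hρ)
    ((convex_ball z ρ).isPreconnected.subset_connectedComponentIn
      (Metric.mem_ball_self hρ) hρX)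

theorem theorem1p6 {n m : ℕ} (hmn : m ≤ n)
    (c : EuclideanSpace ℂ (Fin n)) (r : ℝ) (hr : 0 < r) (δ : ℝ) (hδ : 0 < δ)
    (g : EuclideanSpace ℂ (Fin n) → EuclideanSpace ℂ (Fin m))
    (hg : HolomorphicOnClosedBall g c r)
    (K : Set (EuclideanSpace ℂ (Fin n))) (hK : IsIsland g c r δ K) :
    (interior K).Nonempty ∧ ∃ z ∈ interior K, g z = 0 := by
  obtain ⟨z, hz, hz0⟩ := hK.exists_zero hmn hδ.le hg
  have hint := hK.mem_interior_of_eq_zero hδ hg hz hz0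
  exact ⟨⟨z, hint⟩, z, hint, hz0⟩
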